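/- **Setting.** For $i\ge 2$ let $X_i$ be an alphabet with $i$ letters, $X_i^*$ the set of finite strings over $X_i$ and $|x|_i$ the length of $x\in X_i^*$. A *machine* on $X_2^*$ is a partial computable function $T$ from $X_2^*$ to $X_2^*$ whose domain is prefix-free; put $H_T(x)=\min\{|p|_2 : T(p)=x\}$ (with $\min\emptyset=\infty$). A machine $U$ is *universal* if for every machine $T$ there is a constant $c$ with $H_U(x)\le H_T(x)+c$ for all $x$. Fix a universal machine $U_2$ and write $H_2=H_{U_2}$ (which is finite everywhere). Fix a language $L\subseteq X_i^*$ (for instance $L=X_i^*$). A *Gödel numbering* for $L$ is a one-to-one partial computable function $g$ from $X_i^*$ to $X_2^*$ with domain $L$; let $G$ be the set of all of them. A *(complexity measure) builder* is a map $\rho$ which sends every $g\in G$ to the function $\rho_g:L\to\mathbb Q$, $\rho_g(u)=\hat\rho_i(H_2(g(u)),|u|_i)$, for some computable function $\hat\rho_i:\mathbb N\times\mathbb N\to\mathbb Q$, its *witness*. A *Gödel-type theory* $\mathcal F$ written in $X_i$ consists of a finite first-order signature with equality and a computably enumerable set of sentences over it (the postulates of $\mathcal F$), with the following conventions and properties.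 Formulae are written in the usual way with parentheses, commas, connectives, quantifiers and variables (a letter $v$ followed by a number in binary): atomic formulae are $(s=t)$ and $R(t_1,\dots,t_k)$, terms are variables and $f(t_1,\dots,t_k)$, compound formulae are $\neg\varphi$, $(\varphi\wedge\psi)$, $(\varphi\vee\psi)$, $(\varphi\to\psi)$, $\forall v_n\varphi$, $\exists v_n\varphi$; each symbol is written as a letter or a block of letters of $X_i$, no block being an initial segment of the block of another symbol. We write $\mathcal F\vdash x$ if $x\in X_i^*$ is the written form of a formula derivable from the postulates in classical first-order logic with equality. It is required that $\mathcal F$ is consistent, and that there is a relative interpretation of the language of arithmetic ($0$, successor, $+$, $\cdot$) in the language of $\mathcal F$ under which $\mathcal F$ proves Robinson arithmetic and under which every arithmetical sentence that $\mathcal F$ proves is true in $\mathbb N$. A builder $\rho$ is *acceptable* if for every $g\in G$: 1. for every Gödel-type theory $\mathcal F$ written in $X_i$ there is an integer $N_{\mathcal F}$ such that $\rho_g(x)<N_{\mathcal F}$ for every $x\in L$ with $\mathcal F\vdash x$; 2. for every integer $N$, $\displaystyle\lim_{n\to\infty} i^{-n}\cdot\operatorname{card}\{x\in L : |x|_i=n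 \text{ and } \rho_g(x)\le N\}=0$; 3. for every $g'\in G$ there is a constant $c$ such that $|\rho_g(u)-\rho_{g'}(u)|\le c$ for every $u\in L$. An *acceptable complexity measure* is a function of the form $\rho_g$ with $\rho$ an acceptable builder and $g\in G$. **Proposition.** For $g\in G$ and $x\in L$ let $\delta_g(x)=H_2(g(x))-\lceil \log_2(i)\cdot|x|_i\rceil$. Then $g\mapsto\delta_g$ is an acceptable builder. In particular $\delta_g$ is an acceptable complexity measure for every $g\in G$. -/

import Mathlib

open Filter Topology

/-! ### Program-size complexity

`X_i` is `Fin i`, strings are `List (Fin i)`, and string-processing Turing machines are the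
partial recursive functions on strings. -/

/-- No element of `S` is a proper extension of another one. -/
def IsPrefixFree {α : Type} (S : Set (List α)) : Prop :=
  ∀ x z : List α, x ∈ S → x ++ z ∈ S → z = []

/-- A self-delimiting Turing machine over the alphabet `X_i`. -/
def IsMachine {i : ℕ} (T : List (Fin i) →. List (Fin i)) : Prop :=
  Partrec T ∧ IsPrefixFree {p | (T p).Dom}

/-- Program-size complexity relative to `T`: the least length of a program for `x`, and `⊤` if
there is none. -/
noncomputable def complexity {i : ℕ} (T : List (Fin i) →. List (Fin i)) (x : List (Fin i)) : ℕ∞ :=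
  ⨅ p : {p : List (Fin i) // x ∈ T p}, (p.1.length : ℕ∞)

/-- A universal machine: one that minimizes program-size complexity up to an additive constant. -/
def IsUniversal {i : ℕ} (U : List (Fin i) →. List (Fin i)) : Prop :=
  IsMachine U ∧ ∀ T : List (Fin i) →. List (Fin i), IsMachine T →
    ∃ c : ℕ, ∀ x, complexity U x ≤ complexity T x + c

/-- The complexity as a natural number; meaningful for a universal machine, see
`coe_natComplexity`. -/
noncomputable def natComplexity {i : ℕ} (U : List (Fin i) →. List (Fin i)) (x : List (Fin i)) : ℕ :=
  (complexity U x).toNat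

/-- For a universal machine every string has finite complexity, so nothing is lost in
`natComplexity`. -/
theorem coe_natComplexity {i : ℕ} {U : List (Fin i) →. List (Fin i)} (hU : IsUniversal U)
    (x : List (Fin i)) : (natComplexity U x : ℕ∞) = complexity U x := by
  let T : List (Fin i) →. List (Fin i) := fun p => ((if p = [] then some x else none : Option _) :)
  have hT : IsMachine T := by
    refine ⟨?_, ?_⟩
    · have : Computable (fun p : List (Fin i) => (if p = [] then some x else none : Option _)) :=
        (Primrec.ite (Primrec.eq.comp Primrec.id (Primrec.const []))
          (Primrec.const _) (Primrec.const _)).to_comp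
      exact this.ofOption
    · intro a z ha haz
      by_contra hz
      have : a ++ z ≠ [] := by simp [hz]
      simp [T, this] at haz
  obtain ⟨c, hc⟩ := hU.2 T hT
  have h0 : complexity T x ≤ 0 := by
    have hx : x ∈ T [] := by simp [T]
    exact iInf_le_of_le (⟨[], hx⟩ : {p // x ∈ T p}) (by simp)
  have : complexity U x ≠ ⊤ := by
    intro h
    have h1 := hc x
    rw [h, nonpos_iff_eq_zero.mp h0, zero_add, top_le_iff] at h1
    exact ENat.natCast_ne_top c h1
  exact ENat.natCast_toNat this

/-! ### First-order theories, written as strings -/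

/-- A finite first-order signature (with equality). -/
structure Sig where
  numFun : ℕ
  numRel : ℕ
  funArity : Fin numFun → ℕ
  relArity : Fin numRel → ℕ

/-- The typographical symbols with which the formulae over `S` are written. The variable `v_n` is
written as the letter `v` followed by the number `n` in binary. -/
inductive Symb (S : Sig) : Type
  | lpar | rpar | comma | eq | neg | and | or | imp | all | ex | v
  | bit (b : Bool)
  | fn (f : Fin S.numFun)
  | rel (r : Fin S.numRel)

inductive Trm (S : Sig) : Type
  | var (n : ℕ)
  | app (f : Fin S.numFun) (args : Fin (S.funArity f) → Trm S)

inductive Fml (S : Sig) : Type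
  | eq (s t : Trm S)
  | rel (r : Fin S.numRel) (args : Fin (S.relArity r) → Trm S)
  | neg (φ : Fml S)
  | and (φ ψ : Fml S)
  | or (φ ψ : Fml S)
  | imp (φ ψ : Fml S)
  | all (n : ℕ) (φ : Fml S)
  | ex (n : ℕ) (φ : Fml S)

/-- Binary digits, most significant first; `0` is written `0`. -/
def binaryDigits (n : ℕ) : List Bool :=
  if n = 0 then [false] else (Nat.bits n).reverse

def varSyms {S : Sig} (n : ℕ) : List (Symb S) :=
  Symb.v :: (binaryDigits n).map Symb.bit

/-- `(w₁,…,w_k)` -/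
def argSyms {S : Sig} {k : ℕ} (w : Fin k → List (Symb S)) : List (Symb S) :=
  Symb.lpar :: List.intercalate [Symb.comma] (List.ofFn w) ++ [Symb.rpar]

namespace Trm

variable {S : Sig}

/-- The term as a string of symbols: `v_n` or `f(t₁,…,t_k)`. -/
def syms : Trm S → List (Symb S)
  | var n => varSyms n
  | app f args => Symb.fn f :: argSyms (fun j => (args j).syms)

/-- The variable `v_x` occurs in the term. -/
def Occurs (x : ℕ) : Trm S → Prop
  | var n => n = x
  | app _ args => ∃ j, (args j).Occurs x

/-- Replace the variable `v_x` by the term `u`. -/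
def subst (x : ℕ) (u : Trm S) : Trm S → Trm S
  | var n => if n = x then u else var n
  | app f args => app f (fun j => subst x u (args j))

end Trm

namespace Fml

variable {S : Sig}

/-- The formula as a string of symbols: `(s=t)`, `R(t₁,…,t_k)`, `¬φ`, `(φ∧ψ)`, `(φ∨ψ)`, `(φ→ψ)`,
`∀v_nφ`, `∃v_nφ`. -/
def syms : Fml S → List (Symb S)
  | eq s t => Symb.lpar :: s.syms ++ [Symb.eq] ++ t.syms ++ [Symb.rpar]
  | rel r args => Symb.rel r :: argSyms (fun j => (args j).syms)
  | neg φ => Symb.neg :: φ.syms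
  | and φ ψ => Symb.lpar :: φ.syms ++ [Symb.and] ++ ψ.syms ++ [Symb.rpar]
  | or φ ψ => Symb.lpar :: φ.syms ++ [Symb.or] ++ ψ.syms ++ [Symb.rpar]
  | imp φ ψ => Symb.lpar :: φ.syms ++ [Symb.imp] ++ ψ.syms ++ [Symb.rpar]
  | all n φ => Symb.all :: varSyms n ++ φ.syms
  | ex n φ => Symb.ex :: varSyms n ++ φ.syms

/-- The variable `v_x` occurs free in the formula. -/
def FreeIn (x : ℕ) : Fml S → Prop
  | eq s t => s.Occurs x ∨ t.Occurs x
  | rel _ args => ∃ j, (args j).Occurs x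
  | neg φ => φ.FreeIn x
  | and φ ψ => φ.FreeIn x ∨ ψ.FreeIn x
  | or φ ψ => φ.FreeIn x ∨ ψ.FreeIn x
  | imp φ ψ => φ.FreeIn x ∨ ψ.FreeIn x
  | all n φ => n ≠ x ∧ φ.FreeIn x
  | ex n φ => n ≠ x ∧ φ.FreeIn x

/-- The variable `v_x` is quantified somewhere in the formula. -/
def BoundIn (x : ℕ) : Fml S → Prop
  | eq _ _ => False
  | rel _ _ => False
  | neg φ => φ.BoundIn x
  | and φ ψ => φ.BoundIn x ∨ ψ.BoundIn x
  | or φ ψ => φ.BoundIn x ∨ ψ.BoundIn x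
  | imp φ ψ => φ.BoundIn x ∨ ψ.BoundIn x
  | all n φ => n = x ∨ φ.BoundIn x
  | ex n φ => n = x ∨ φ.BoundIn x

def Closed (φ : Fml S) : Prop := ∀ x, ¬ φ.FreeIn x

/-- Replace the free occurrences of the variable `v_x` by the term `u`. -/
def subst (x : ℕ) (u : Trm S) : Fml S → Fml S
  | eq s t => eq (Trm.subst x u s) (Trm.subst x u t)
  | rel r args => rel r (fun j => Trm.subst x u (args j))
  | neg φ => neg (φ.subst x u)
  | and φ ψ => and (φ.subst x u) (ψ.subst x u)
  | or φ ψ => or (φ.subst x u) (ψ.subst x u)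
  | imp φ ψ => imp (φ.subst x u) (ψ.subst x u)
  | all n φ => if n = x then all n φ else all n (φ.subst x u)
  | ex n φ => if n = x then ex n φ else ex n (φ.subst x u)

/-- The term `u` is free for `v_x` in the formula: `subst x u` captures no variable. -/
def FreeFor (x : ℕ) (u : Trm S) : Fml S → Prop
  | eq _ _ => True
  | rel _ _ => True
  | neg φ => φ.FreeFor x u
  | and φ ψ => φ.FreeFor x u ∧ ψ.FreeFor x u
  | or φ ψ => φ.FreeFor x u ∧ ψ.FreeFor x u
  | imp φ ψ => φ.FreeFor x u ∧ ψ.FreeFor x u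
  | all n φ => ¬ (all n φ).FreeIn x ∨ (¬ u.Occurs n ∧ φ.FreeFor x u)
  | ex n φ => ¬ (ex n φ).FreeIn x ∨ (¬ u.Occurs n ∧ φ.FreeFor x u)

end Fml

/-- Natural deduction for classical first-order logic with equality: `Derives Γ φ` means that `φ` is
derivable from the assumptions `Γ`. -/
inductive Derives {S : Sig} : Set (Fml S) → Fml S → Prop
  | assume {Γ : Set (Fml S)} {φ : Fml S} : φ ∈ Γ → Derives Γ φ
  | negI {Γ : Set (Fml S)} {φ ψ : Fml S} :
      Derives (insert φ Γ) ψ → Derives (insert φ Γ) ψ.neg → Derives Γ φ.neg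
  | negE {Γ : Set (Fml S)} {φ ψ : Fml S} :
      Derives (insert φ.neg Γ) ψ → Derives (insert φ.neg Γ) ψ.neg → Derives Γ φ
  | andI {Γ : Set (Fml S)} {φ ψ : Fml S} : Derives Γ φ → Derives Γ ψ → Derives Γ (φ.and ψ)
  | andE₁ {Γ : Set (Fml S)} {φ ψ : Fml S} : Derives Γ (φ.and ψ) → Derives Γ φ
  | andE₂ {Γ : Set (Fml S)} {φ ψ : Fml S} : Derives Γ (φ.and ψ) → Derives Γ ψ
  | orI₁ {Γ : Set (Fml S)} {φ ψ : Fml S} : Derives Γ φ → Derives Γ (φ.or ψ)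
  | orI₂ {Γ : Set (Fml S)} {φ ψ : Fml S} : Derives Γ ψ → Derives Γ (φ.or ψ)
  | orE {Γ : Set (Fml S)} {φ ψ χ : Fml S} :
      Derives Γ (φ.or ψ) → Derives (insert φ Γ) χ → Derives (insert ψ Γ) χ →
      Derives Γ χ
  | impI {Γ : Set (Fml S)} {φ ψ : Fml S} : Derives (insert φ Γ) ψ → Derives Γ (φ.imp ψ)
  | impE {Γ : Set (Fml S)} {φ ψ : Fml S} : Derives Γ (φ.imp ψ) → Derives Γ φ → Derives Γ ψ
  | allI {Γ : Set (Fml S)} {φ : Fml S} {x y : ℕ} :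
      φ.FreeFor x (Trm.var y) → ¬ (φ.all x).FreeIn y → (∀ γ ∈ Γ, ¬ γ.FreeIn y) →
      Derives Γ (φ.subst x (Trm.var y)) → Derives Γ (φ.all x)
  | allE {Γ : Set (Fml S)} {φ : Fml S} {x : ℕ} {u : Trm S} :
      φ.FreeFor x u → Derives Γ (φ.all x) → Derives Γ (φ.subst x u)
  | exI {Γ : Set (Fml S)} {φ : Fml S} {x : ℕ} {u : Trm S} :
      φ.FreeFor x u → Derives Γ (φ.subst x u) → Derives Γ (φ.ex x)
  | exE {Γ : Set (Fml S)} {φ ψ : Fml S} {x y : ℕ} :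
      φ.FreeFor x (Trm.var y) → ¬ (φ.ex x).FreeIn y → ¬ ψ.FreeIn y →
      (∀ γ ∈ Γ, ¬ γ.FreeIn y) → Derives Γ (φ.ex x) →
      Derives (insert (φ.subst x (Trm.var y)) Γ) ψ → Derives Γ ψ
  | eqI {Γ : Set (Fml S)} {t : Trm S} : Derives Γ (Fml.eq t t)
  | eqE {Γ : Set (Fml S)} {φ : Fml S} {x : ℕ} {s t : Trm S} :
      φ.FreeFor x s → φ.FreeFor x t → Derives Γ (Fml.eq s t) →
      Derives Γ (φ.subst x s) → Derives Γ (φ.subst x t)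

/-! ### Formalizing arithmetic in a theory -/

/-- Arithmetical formulae, in relational form: the atomic formulae are `v_a = v_b`, `v_a = 0`,
`S v_a = v_b`, `v_a + v_b = v_c` and `v_a * v_b = v_c`. -/
inductive Arith : Type
  | eq (a b : ℕ)
  | zero (a : ℕ)
  | succ (a b : ℕ)
  | add (a b c : ℕ)
  | mul (a b c : ℕ)
  | neg (φ : Arith)
  | and (φ ψ : Arith)
  | or (φ ψ : Arith)
  | imp (φ ψ : Arith)
  | all (n : ℕ) (φ : Arith)
  | ex (n : ℕ) (φ : Arith)

namespace Arith

def FreeIn (x : ℕ) : Arith → Prop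
  | eq a b => a = x ∨ b = x
  | zero a => a = x
  | succ a b => a = x ∨ b = x
  | add a b c => a = x ∨ b = x ∨ c = x
  | mul a b c => a = x ∨ b = x ∨ c = x
  | neg φ => φ.FreeIn x
  | and φ ψ => φ.FreeIn x ∨ ψ.FreeIn x
  | or φ ψ => φ.FreeIn x ∨ ψ.FreeIn x
  | imp φ ψ => φ.FreeIn x ∨ ψ.FreeIn x
  | all n φ => n ≠ x ∧ φ.FreeIn x
  | ex n φ => n ≠ x ∧ φ.FreeIn x

def Closed (φ : Arith) : Prop := ∀ x, ¬ φ.FreeIn x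

/-- Truth in the standard model `ℕ` under the assignment `e`. -/
def Holds : (ℕ → ℕ) → Arith → Prop
  | e, eq a b => e a = e b
  | e, zero a => e a = 0
  | e, succ a b => e a + 1 = e b
  | e, add a b c => e a + e b = e c
  | e, mul a b c => e a * e b = e c
  | e, neg φ => ¬ φ.Holds e
  | e, and φ ψ => φ.Holds e ∧ ψ.Holds e
  | e, or φ ψ => φ.Holds e ∨ ψ.Holds e
  | e, imp φ ψ => φ.Holds e → ψ.Holds e
  | e, all n φ => ∀ a, φ.Holds (Function.update e n a)
  | e, ex n φ => ∃ a, φ.Holds (Function.update e n a)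

/-- Robinson arithmetic in relational form: `0`, `S`, `+`, `*` are total functions that satisfy the
usual seven postulates. -/
def robinson : Set Arith := {
  ex 0 (zero 0),
  all 0 (all 1 (imp (and (zero 0) (zero 1)) (eq 0 1))),
  all 0 (ex 1 (succ 0 1)),
  all 0 (all 1 (all 2 (imp (and (succ 0 1) (succ 0 2)) (eq 1 2)))),
  all 0 (all 1 (ex 2 (add 0 1 2))),
  all 0 (all 1 (all 2 (all 3 (imp (and (add 0 1 2) (add 0 1 3)) (eq 2 3))))),
  all 0 (all 1 (ex 2 (mul 0 1 2))),
  all 0 (all 1 (all 2 (all 3 (imp (and (mul 0 1 2) (mul 0 1 3)) (eq 2 3))))),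
  all 0 (all 1 (imp (succ 0 1) (neg (zero 1)))),
  all 0 (all 1 (all 2 (imp (and (succ 0 2) (succ 1 2)) (eq 0 1)))),
  all 0 (or (zero 0) (ex 1 (succ 1 0))),
  all 0 (all 1 (imp (zero 1) (add 0 1 0))),
  all 0 (all 1 (all 2 (all 3 (all 4
    (imp (and (succ 1 2) (and (add 0 1 3) (succ 3 4))) (add 0 2 4)))))),
  all 0 (all 1 (imp (zero 1) (mul 0 1 1))),
  all 0 (all 1 (all 2 (all 3 (all 4
    (imp (and (succ 1 2) (and (mul 0 1 3) (add 3 0 4))) (mul 0 2 4))))))}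

end Arith

/-- A relative interpretation of the vocabulary of arithmetic in the language of `S`: formulae that
say "`v₀` is a natural number", "`v₀ = 0`", "`S v₀ = v₁`", "`v₀ + v₁ = v₂`", "`v₀ * v₁ = v₂`", whose
quantified variables all have an index below `shift`. -/
structure ArithInterpretation (S : Sig) where
  nat : Fml S
  zero : Fml S
  succ : Fml S
  add : Fml S
  mul : Fml S
  shift : ℕ
  three_le_shift : 3 ≤ shift
  nat_free : ∀ x, nat.FreeIn x → x < 1
  zero_free : ∀ x, zero.FreeIn x → x < 1
  succ_free : ∀ x, succ.FreeIn x → x < 2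
  add_free : ∀ x, add.FreeIn x → x < 3
  mul_free : ∀ x, mul.FreeIn x → x < 3
  bound_lt : ∀ x, (nat.BoundIn x ∨ zero.BoundIn x ∨ succ.BoundIn x ∨ add.BoundIn x ∨
    mul.BoundIn x) → x < shift

namespace ArithInterpretation

variable {S : Sig} (I : ArithInterpretation S)

/-- The variable of `S` that stands for the arithmetical variable `v_a`. Its index is at least
`shift`, so that the substitutions in `translate` capture nothing and do not interfere. -/
def tvar (a : ℕ) : Trm S := Trm.var (a + I.shift)

/-- The translation of arithmetical formulae, with quantifiers relativized to `nat`. -/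
def translate : Arith → Fml S
  | .eq a b => .eq (I.tvar a) (I.tvar b)
  | .zero a => I.zero.subst 0 (I.tvar a)
  | .succ a b => (I.succ.subst 0 (I.tvar a)).subst 1 (I.tvar b)
  | .add a b c => ((I.add.subst 0 (I.tvar a)).subst 1 (I.tvar b)).subst 2 (I.tvar c)
  | .mul a b c => ((I.mul.subst 0 (I.tvar a)).subst 1 (I.tvar b)).subst 2 (I.tvar c)
  | .neg φ => .neg (translate φ)
  | .and φ ψ => .and (translate φ) (translate ψ)
  | .or φ ψ => .or (translate φ) (translate ψ)
  | .imp φ ψ => .imp (translate φ) (translate ψ)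
  | .all n φ => .all (n + I.shift) (.imp (I.nat.subst 0 (I.tvar n)) (translate φ))
  | .ex n φ => .ex (n + I.shift) (.and (I.nat.subst 0 (I.tvar n)) (translate φ))

end ArithInterpretation

/-- A theory, written in the alphabet `X_i`, that satisfies the hypotheses of the incompleteness
theorem: finitely specified (computably enumerable postulates), consistent, strong enough to
formalize arithmetic, and arithmetically sound. Each symbol is written as a letter or a block of
letters of `X_i` (`code`), no block being an initial segment of another one. -/
structure GodelTheory (i : ℕ) where
  sig : Sig
  code : Symb sig → List (Fin i)
  code_prefixFree : ∀ a b, code a <+: code b → a = b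
  Ax : Set (Fml sig)
  closed : ∀ φ ∈ Ax, φ.Closed
  ce : REPred (fun w : List (Fin i) => ∃ φ ∈ Ax, φ.syms.flatMap code = w)
  consistent : ¬ ∃ φ, Derives Ax φ ∧ Derives Ax φ.neg
  interp : ArithInterpretation sig
  strong : ∀ φ ∈ Arith.robinson, Derives Ax (interp.translate φ)
  sound : ∀ φ : Arith, φ.Closed → Derives Ax (interp.translate φ) → ∀ e, φ.Holds e

/-- `F ⊢ w`: the string `w` is (the written form of) a theorem of `F`. -/
def GodelTheory.Proves {i : ℕ} (F : GodelTheory i) (w : List (Fin i)) : Prop :=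
  ∃ φ : Fml F.sig, Derives F.Ax φ ∧ φ.syms.flatMap F.code = w

/-! ### Acceptable complexity measures -/

/-- A Gödel numbering for the language `L ⊆ X_i^*`: a computable one-to-one function from `L` to
`X_2^*`. -/
structure GodelNumbering {i : ℕ} (L : Set (List (Fin i))) where
  toFun : List (Fin i) →. List (Fin 2)
  partrec : Partrec toFun
  dom_iff : ∀ x, (toFun x).Dom ↔ x ∈ L
  inj : ∀ x y z, z ∈ toFun x → z ∈ toFun y → x = y

/-- The value `g(x)` for `x ∈ L`. -/
def GodelNumbering.val {i : ℕ} {L : Set (List (Fin i))} (g : GodelNumbering L) (x : L) :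
    List (Fin 2) :=
  (g.toFun x).get ((g.dom_iff x).2 x.2)

/-- A function `ℕ × ℕ → ℚ` is computable: numerator (as a difference) and denominator are. -/
def IsComputableRat (f : ℕ × ℕ → ℚ) : Prop :=
  ∃ a b d : ℕ × ℕ → ℕ, Computable a ∧ Computable b ∧ Computable d ∧
    ∀ p, f p = ((a p : ℚ) - b p) / (d p + 1)

section Measures

variable {i : ℕ} {L : Set (List (Fin i))} (U : List (Fin 2) →. List (Fin 2))

/-- `ρ` is the complexity measure builder `g ↦ [u ↦ w(H₂(g(u)), |u|)]` of some computable
witness `w`. -/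
def IsBuilder (ρ : GodelNumbering L → L → ℚ) : Prop :=
  ∃ w : ℕ × ℕ → ℚ, IsComputableRat w ∧
    ∀ g u, ρ g u = w (natComplexity U (g.val u), u.1.length)

/-- A builder is acceptable if, for every Gödel numbering, the measure it builds is bounded on the
theorems of each theory, has sublevel sets of vanishing density, and is, up to a constant,
independent of the Gödel numbering. -/
structure IsAcceptableBuilder (ρ : GodelNumbering L → L → ℚ) : Prop where
  builder : IsBuilder U ρ
  bound : ∀ g, ∀ F : GodelTheory i, ∃ N : ℤ, ∀ x : L, F.Proves x → ρ g x < N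
  lim : ∀ g, ∀ N : ℤ, Tendsto
    (fun n : ℕ => ((i : ℝ) ^ n)⁻¹ * (Set.ncard {x : L | x.1.length = n ∧ ρ g x ≤ N} : ℝ))
    atTop (𝓝 0)
  inva : ∀ g g', ∃ c : ℚ, ∀ u : L, |ρ g u - ρ g' u| ≤ c

/-- An acceptable complexity measure: one that is built by an acceptable builder. -/
def IsAcceptableMeasure (μ : L → ℚ) : Prop :=
  ∃ ρ : GodelNumbering L → L → ℚ, IsAcceptableBuilder U ρ ∧ ∃ g, μ = ρ g

/-- `δ_g(x) = H₂(g(x)) - ⌈log₂(i) · |x|⌉` -/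
noncomputable def delta (g : GodelNumbering L) (x : L) : ℚ :=
  (natComplexity U (g.val x) : ℚ) - (⌈Real.logb 2 (i : ℝ) * (x.1.length : ℝ)⌉ : ℤ)

end Measures

/-! ### Computability -/

/-! Since `⌈log₂ i · n⌉` is the integer `Nat.clog 2 (i ^ n)`, the measure has a computable witness.
The three acceptability conditions rest on separate arguments.

Independence of the numbering: `g` is injective and partial computable, hence so is its inverse.
Thus `g' ∘ g⁻¹` is partial computable, and applying such a map raises program-size complexity by at
most a constant (`exists_natComplexity_map_le`).

Vanishing density: a string of length `n` with `δ ≤ N` has a program of length at most `k = ⌈log₂ i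
· n⌉ + max(N, 0)`, and distinct strings have distinct programs. By Kraft's inequality a prefix-free
set has only `o(2 ^ k)` elements of length at most `k` (`IsPrefixFree.tendsto_ncard`), while `2 ^ k`
is at most a constant times `i ^ n`.

Boundedness on theorems: every theorem is a written formula, and the bound holds for all of these.
Formulae are self-delimiting, because each ends at the parenthesis closing its first one
(`Fml.parRun_syms`), so they lie in a decidable prefix-free set. Such a set has a computable binary
prefix code of the Shannon–Fano–Elias kind, with word length `⌈log₂ i · n⌉ + 1`
(`natComplexity_le_of_prefixFree`). -/

theorem exists_partrec_inverse {α β : Type*} [Primcodable α] [Primcodable β] {f : α →. β}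
    (hf : Partrec f) (inj : ∀ x y z, z ∈ f x → z ∈ f y → x = y) :
    ∃ h : β →. α, Partrec h ∧ ∀ a b, a ∈ h b ↔ b ∈ f a := by
  obtain ⟨c, hc⟩ := Nat.Partrec.Code.exists_code.1 hf
  have hmem : ∀ (m : ℕ) (a : α) (b : β), Encodable.decode m = some a →
      (Encodable.encode b ∈ c.eval m ↔ b ∈ f a) := by
    intro m a b hm
    simp [hc, hm]
  -- Dovetailing: `n` codes both a step bound and a candidate preimage.
  let s : β → ℕ → Option α := fun b n =>
    if Nat.Partrec.Code.evaln n.unpair.1 c n.unpair.2 = some (Encodable.encode b) then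
      Encodable.decode n.unpair.2 else none
  have hs : Primrec₂ s := by
    have hu : Primrec fun p : β × ℕ => p.2.unpair := Primrec.unpair.comp Primrec.snd
    refine Primrec.ite (Primrec.eq.comp ?_ ?_) ?_ (Primrec.const _)
    · exact Nat.Partrec.Code.primrec_evaln.comp
        (((Primrec.fst.comp hu).pair (Primrec.const c)).pair (Primrec.snd.comp hu))
    · exact Primrec.option_some.comp (Primrec.encode.comp Primrec.fst)
    · exact Primrec.decode.comp (Primrec.snd.comp hu)
  refine ⟨fun b => Nat.rfindOpt (s b), Partrec.rfindOpt hs.to_comp, fun a b => ?_⟩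
  have sound : ∀ a, a ∈ Nat.rfindOpt (s b) → b ∈ f a := by
    intro a ha
    obtain ⟨n, hn⟩ := Nat.rfindOpt_spec ha
    simp only [s] at hn
    split_ifs at hn with h
    · exact (hmem _ _ _ hn).1 (Nat.Partrec.Code.evaln_complete.2 ⟨_, h⟩)
    · simp at hn
  refine ⟨sound a, fun hb => ?_⟩
  have hdom : (Nat.rfindOpt (s b)).Dom := by
    obtain ⟨k, hk⟩ := Nat.Partrec.Code.evaln_complete.1
      ((hmem _ a b (Encodable.encodek a)).2 hb)
    refine Nat.rfindOpt_dom.2 ⟨Nat.pair k (Encodable.encode a), a, ?_⟩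
    have hk' : Nat.Partrec.Code.evaln k c (Encodable.encode a) = some (Encodable.encode b) := hk
    simp [s, hk']
  have h := sound _ (Part.get_mem hdom)
  -- The search returns some preimage of `b`; injectivity identifies it with `a`.
  exact inj _ _ _ hb h ▸ Part.get_mem hdom

theorem exists_partrec_search {α β : Type*} [Primcodable α] [Primcodable β] {R : α → β → Prop}
    (hR : PrimrecRel R) :
    ∃ h : α →. β, Partrec h ∧ (∀ a b, b ∈ h a → R a b) ∧ ∀ a b, R a b → (h a).Dom := by
  classical
  let s : α → ℕ → Option β := fun a n =>
    (Encodable.decode n : Option β).bind fun b => if R a b then some b else none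
  have hs : Primrec₂ s := by
    refine Primrec.option_bind (Primrec.decode.comp Primrec.snd) ?_
    exact Primrec.ite (hR.comp (Primrec.fst.comp Primrec.fst) Primrec.snd)
      (Primrec.option_some.comp Primrec.snd) (Primrec.const _)
  refine ⟨fun a => Nat.rfindOpt (s a), Partrec.rfindOpt hs.to_comp, fun a b hb => ?_,
    fun a b hab => Nat.rfindOpt_dom.2 ⟨Encodable.encode b, b, ?_⟩⟩
  · obtain ⟨n, hn⟩ := Nat.rfindOpt_spec hb
    simp only [s, Option.mem_def, Option.bind_eq_some_iff, Option.ite_none_right_eq_some,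
      Option.some.injEq] at hn
    obtain ⟨b', -, h, rfl⟩ := hn
    exact h
  · simp [s, hab]

theorem primrec₂_pow : Primrec₂ ((· ^ ·) : ℕ → ℕ → ℕ) :=
  Primrec₂.unpaired'.1 Nat.Primrec.pow

/-- A bounded search for the logarithm, which makes it primitive recursive. Doubling `m` makes the
strict inequality match `k ≤ clog`, also at `k = 0`. -/
theorem findGreatest_two_pow_lt {m : ℕ} (hm : 1 ≤ m) :
    Nat.findGreatest (fun k => 2 ^ k < 2 * m) m = Nat.clog 2 m := by
  have key : ∀ k, 2 ^ k < 2 * m ↔ k ≤ Nat.clog 2 m := by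
    rintro (_ | k)
    · simp; omega
    · rw [Nat.succ_le_iff, Nat.lt_clog_iff_pow_lt one_lt_two, pow_succ]
      omega
  refine Nat.findGreatest_eq_iff.2 ⟨?_, fun _ => (key _).2 le_rfl, fun n hn _ h => ?_⟩
  · exact Nat.clog_le_of_le_pow Nat.lt_two_pow_self.le
  · exact absurd ((key n).1 h) (by omega)

theorem primrec_clog_pow {i : ℕ} (hi : 1 ≤ i) : Primrec fun n : ℕ => Nat.clog 2 (i ^ n) := by
  have hp : Primrec fun n : ℕ => i ^ n := primrec₂_pow.comp (Primrec.const i) Primrec.id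
  have h : PrimrecRel fun n k : ℕ => 2 ^ k < 2 * i ^ n :=
    Primrec.nat_lt.comp (primrec₂_pow.comp (Primrec.const 2) Primrec.snd)
      (Primrec.nat_mul.comp (Primrec.const 2) (hp.comp Primrec.fst))
  exact (Primrec.nat_findGreatest hp h).of_eq fun n =>
    findGreatest_two_pow_lt (Nat.one_le_pow _ _ hi)

theorem ceil_logb_mul {i : ℕ} (hi : 1 ≤ i) (n : ℕ) :
    ⌈Real.logb 2 (i : ℝ) * (n : ℝ)⌉ = (Nat.clog 2 (i ^ n) : ℤ) := by
  have h0 : 0 ≤ Real.logb 2 (i : ℝ) * (n : ℝ) :=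
    mul_nonneg (Real.logb_nonneg one_lt_two (by exact_mod_cast hi)) n.cast_nonneg
  rw [← Int.natCast_ceil_eq_ceil h0, ← Real.natCeil_logb_natCast]
  congr 2
  push_cast
  rw [Real.logb_pow, mul_comm]

/-! ### Program-size complexity -/

theorem complexity_le_of_mem {i : ℕ} {T : List (Fin i) →. List (Fin i)} {p x : List (Fin i)}
    (h : x ∈ T p) : complexity T x ≤ p.length :=
  iInf_le_of_le (⟨p, h⟩ : {p // x ∈ T p}) le_rfl

theorem exists_program {i : ℕ} {U : List (Fin i) →. List (Fin i)} (hU : IsUniversal U)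
    (x : List (Fin i)) : ∃ p, x ∈ U p ∧ p.length = natComplexity U x := by
  have h := coe_natComplexity hU x
  -- An empty infimum in `ℕ∞` would be `⊤`, contradicting finiteness.
  have hne : Nonempty {p : List (Fin i) // x ∈ U p} := by
    by_contra hne
    rw [not_nonempty_iff] at hne
    simp [complexity] at h
  obtain ⟨p, hp⟩ := ENat.exists_eq_iInf fun p : {p : List (Fin i) // x ∈ U p} => (p.1.length : ℕ∞)
  refine ⟨p.1, p.2, ?_⟩
  have : (p.1.length : ℕ∞) = natComplexity U x := hp.trans h.symm
  exact_mod_cast this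

theorem natComplexity_le {i : ℕ} {U T : List (Fin i) →. List (Fin i)} (hU : IsUniversal U)
    (hT : IsMachine T) :
    ∃ c : ℕ, ∀ p x, x ∈ T p → natComplexity U x ≤ p.length + c := by
  obtain ⟨c, hc⟩ := hU.2 T hT
  refine ⟨c, fun p x hx => ?_⟩
  have : (natComplexity U x : ℕ∞) ≤ (p.length + c : ℕ) := by
    rw [coe_natComplexity hU]
    push_cast
    exact (hc x).trans (by gcongr; exact complexity_le_of_mem hx)
  exact_mod_cast this

/-- Running `U` and then `f` is a machine: its domain is part of the domain of `U`, so it stays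
prefix-free. -/
theorem exists_natComplexity_map_le {i : ℕ} {U : List (Fin i) →. List (Fin i)} (hU : IsUniversal U)
    {f : List (Fin i) →. List (Fin i)} (hf : Partrec f) :
    ∃ c : ℕ, ∀ x y, y ∈ f x → natComplexity U y ≤ natComplexity U x + c := by
  have hT : IsMachine fun p => (U p).bind f := by
    refine ⟨hU.1.1.bind (hf.comp Computable.snd).to₂, fun x z hx hxz => hU.1.2 x z ?_ ?_⟩
    · exact Part.Dom.of_bind hx
    · exact Part.Dom.of_bind hxz
  obtain ⟨c, hc⟩ := natComplexity_le hU hT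
  refine ⟨c, fun x y hy => ?_⟩
  obtain ⟨p, hp, hl⟩ := exists_program hU x
  rw [← hl]
  exact hc p y (Part.mem_bind hp hy)

/-! ### Kraft's inequality and the number of short programs -/

theorem IsPrefixFree.uniquelyDecodable {α : Type} {S : Set (List α)} (hS : IsPrefixFree S)
    (h0 : [] ∉ S) : InformationTheory.UniquelyDecodable S := by
  intro l
  induction l with
  | nil =>
    intro m _ hm h
    cases m with
    | nil => rfl
    | cons b m =>
      simp only [List.flatten_nil, List.flatten_cons] at h
      have := (List.append_eq_nil_iff.1 h.symm).1
      exact absurd (this ▸ hm b (by simp)) h0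
  | cons a l ih =>
    intro m hl hm h
    cases m with
    | nil =>
      simp only [List.flatten_nil, List.flatten_cons] at h
      have := (List.append_eq_nil_iff.1 h).1
      exact absurd (this ▸ hl a (by simp)) h0
    | cons b m =>
      have ha := hl a (by simp)
      have hb := hm b (by simp)
      simp only [List.flatten_cons] at h
      have hab : a = b := by
        -- Both first words begin the same string, so one extends the other.
        rcases List.append_eq_append_iff.1 h with ⟨z, hz, -⟩ | ⟨z, hz, -⟩
        · have := hS a z ha (hz ▸ hb)
          simp [hz, this]
        · have := hS b z hb (hz ▸ ha)
          simp [hz, this]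
      subst hab
      rw [ih m (fun w hw => hl w (by simp [hw])) (fun w hw => hm w (by simp [hw]))
        (List.append_cancel_left h)]

theorem IsPrefixFree.sum_two_pow_le_one {S : Finset (List (Fin 2))}
    (hS : IsPrefixFree (S : Set (List (Fin 2)))) : ∑ w ∈ S, (1 / 2 : ℝ) ^ w.length ≤ 1 := by
  -- The empty word destroys unique decodability, but a prefix-free set containing it contains
  -- nothing else.
  by_cases h0 : [] ∈ S
  · have : S = {[]} := by
      refine Finset.eq_singleton_iff_unique_mem.2 ⟨h0, fun x hx => ?_⟩
      exact hS [] x h0 (by simpa using hx)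
    simp [this]
  · simpa using InformationTheory.kraft_mcmillan_inequality
      (hS.uniquelyDecodable (by simpa using h0))

theorem IsPrefixFree.mono {α : Type} {S T : Set (List α)} (hT : IsPrefixFree T) (h : S ⊆ T) :
    IsPrefixFree S :=
  fun x z hx hz => hT x z (h hx) (h hz)

theorem IsPrefixFree.summable {D : Set (List (Fin 2))} (hD : IsPrefixFree D) :
    Summable fun p : D => (1 / 2 : ℝ) ^ p.1.length := by
  refine summable_of_sum_le (c := 1) (fun p => by positivity) fun s => ?_
  have := IsPrefixFree.sum_two_pow_le_one (S := s.map (Function.Embedding.subtype _))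
    (hD.mono (by intro x; simp; intro h _; exact h))
  simpa using this

theorem finite_length_le (D : Set (List (Fin 2))) (k : ℕ) : {p ∈ D | p.length ≤ k}.Finite :=
  (List.finite_length_le (Fin 2) k).subset fun _ h => h.2

/-- The quotient is the sum over `p ∈ D` of `2 ^ (-k)` restricted to `|p| ≤ k`. Each term tends to
`0` and is dominated by `2 ^ (-|p|)`, which is summable by Kraft, so dominated convergence applies.
-/
theorem IsPrefixFree.tendsto_ncard {D : Set (List (Fin 2))} (hD : IsPrefixFree D) :
    Tendsto (fun k : ℕ => (Set.ncard {p ∈ D | p.length ≤ k} : ℝ) / 2 ^ k) atTop (𝓝 0) := by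
  let F : ℕ → D → ℝ := fun k p => if p.1.length ≤ k then (1 / 2) ^ k else 0
  have hF : ∀ k p, ‖F k p‖ ≤ (1 / 2 : ℝ) ^ p.1.length := by
    intro k p
    simp only [F]
    split_ifs with h
    · rw [Real.norm_of_nonneg (by positivity)]
      exact pow_le_pow_of_le_one (by norm_num) (by norm_num) h
    · simp
  have hlim : Tendsto (fun k => ∑' p, F k p) atTop (𝓝 (∑' _ : D, (0 : ℝ))) := by
    refine tendsto_tsum_of_dominated_convergence hD.summable (fun p => ?_)
      (Eventually.of_forall hF)
    refine squeeze_zero (fun k => ?_) (fun k => ?_)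
      (tendsto_pow_atTop_nhds_zero_of_lt_one (r := (1 / 2 : ℝ)) (by norm_num) (by norm_num))
    · simp only [F]; split_ifs <;> positivity
    · simp only [F]; split_ifs
      · exact le_rfl
      · positivity
  rw [tsum_zero] at hlim
  refine squeeze_zero (fun k => by positivity) (fun k => ?_) hlim
  have hfin : {p : D | p.1.length ≤ k}.Finite :=
    Set.Finite.of_injOn (f := Subtype.val) (t := {p ∈ D | p.length ≤ k})
      (fun p hp => ⟨p.2, hp⟩) Subtype.val_injective.injOn (finite_length_le D k)
  have hcard : Set.ncard {p ∈ D | p.length ≤ k} = hfin.toFinset.card := by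
    rw [← Set.ncard_eq_toFinset_card _ hfin, ← Set.ncard_image_of_injective _ Subtype.val_injective]
    congr 1
    ext p
    simp [and_comm]
  calc (Set.ncard {p ∈ D | p.length ≤ k} : ℝ) / 2 ^ k
      = ∑ p ∈ hfin.toFinset, F k p := by
        rw [Finset.sum_congr rfl (g := fun _ => (1 / 2 : ℝ) ^ k)
          fun p hp => by simp only [F]; rw [if_pos (by simpa using hp)]]
        simp [hcard, div_eq_mul_inv]
    _ ≤ ∑' p, F k p :=
        (Summable.of_norm_bounded hD.summable (hF k)).sum_le_tsum _ fun p _ => by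
          simp only [F]; split_ifs <;> positivity

/-! ### Coding a computable prefix-free set -/

/-- The number that the string `x` denotes in base `b`, most significant digit first. -/
def baseValue (b : ℕ) (x : List (Fin b)) : ℕ :=
  x.foldl (fun v (d : Fin b) => v * b + (d : ℕ)) 0

theorem foldl_baseValue {b : ℕ} (x : List (Fin b)) (v : ℕ) :
    x.foldl (fun v (d : Fin b) => v * b + (d : ℕ)) v = v * b ^ x.length + baseValue b x := by
  induction x generalizing v with
  | nil => simp [baseValue]
  | cons a x ih =>
    simp only [baseValue, List.foldl_cons, List.length_cons]
    rw [ih, ih (0 * b + a)]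
    ring

theorem baseValue_append {b : ℕ} (x y : List (Fin b)) :
    baseValue b (x ++ y) = baseValue b x * b ^ y.length + baseValue b y := by
  rw [← foldl_baseValue, baseValue, List.foldl_append, baseValue]

theorem baseValue_lt {b : ℕ} (x : List (Fin b)) : baseValue b x < b ^ x.length := by
  induction x using List.reverseRecOn with
  | nil => simp [baseValue]
  | append_singleton x a ih =>
    have ha : baseValue b [a] = a := by simp [baseValue]
    rw [baseValue_append, ha, List.length_append, List.length_singleton, pow_succ, pow_zero, one_mul,
      pow_succ]
    have := a.2
    nlinarith

theorem baseValue_injective {b : ℕ} {x y : List (Fin b)} (hl : x.length = y.length)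
    (h : baseValue b x = baseValue b y) : x = y := by
  induction x generalizing y with
  | nil => exact (List.length_eq_zero_iff.1 hl.symm).symm
  | cons a x ih =>
    obtain _ | ⟨c, y⟩ := y
    · simp at hl
    · simp only [List.length_cons, Nat.add_right_cancel_iff] at hl
      have e : ∀ (d : Fin b) z, baseValue b (d :: z) = d * b ^ z.length + baseValue b z := by
        intro d z
        rw [← List.singleton_append, baseValue_append]
        simp [baseValue]
      rw [e, e, hl] at h
      have hx := baseValue_lt x
      have hy := baseValue_lt y
      rw [hl] at hx
      have hpos : 0 < b ^ y.length := by omega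
      have h1 := congrArg (· / b ^ y.length) h
      have h2 := congrArg (· % b ^ y.length) h
      simp only [Nat.mul_add_mod', Nat.mod_eq_of_lt hx, Nat.mod_eq_of_lt hy] at h2
      simp only [mul_comm _ (b ^ y.length), Nat.mul_add_div hpos, Nat.div_eq_of_lt hx,
        Nat.div_eq_of_lt hy, add_zero] at h1
      rw [ih hl h2, Fin.ext h1]

theorem exists_baseValue_eq {b : ℕ} {n v : ℕ} (hv : v < b ^ n) :
    ∃ x : List (Fin b), x.length = n ∧ baseValue b x = v := by
  induction n generalizing v with
  | zero => exact ⟨[], rfl, by simp at hv; simp [baseValue, hv]⟩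
  | succ n ih =>
    have hb : 0 < b := Nat.pos_of_ne_zero (by rintro rfl; simp at hv)
    obtain ⟨x, hx, hxv⟩ := ih (v := v / b) (Nat.div_lt_of_lt_mul (by rwa [pow_succ'] at hv))
    refine ⟨x ++ [⟨v % b, Nat.mod_lt _ hb⟩], by simp [hx], ?_⟩
    rw [baseValue_append, hxv]
    simp [baseValue, Nat.div_add_mod']

theorem primrec_baseValue (b : ℕ) : Primrec (baseValue b) := by
  have h : Primrec₂ fun (_ : List (Fin b)) (q : ℕ × Fin b) => q.1 * b + (q.2 : ℕ) :=
    Primrec.nat_add.comp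
      (Primrec.nat_mul.comp (Primrec.fst.comp Primrec.snd) (Primrec.const b))
      (Primrec.fin_val.comp (Primrec.snd.comp Primrec.snd))
  exact Primrec.list_foldl Primrec.id (Primrec.const 0) h

/-- The interval of reals whose binary expansion starts with `p` lies in the interval of those whose
expansion in base `i` starts with `x`. -/
def IntervalSubset {i : ℕ} (p : List (Fin 2)) (x : List (Fin i)) : Prop :=
  baseValue i x * 2 ^ p.length ≤ baseValue 2 p * i ^ x.length ∧
    (baseValue 2 p + 1) * i ^ x.length ≤ (baseValue i x + 1) * 2 ^ p.length

theorem primrecRel_intervalSubset {i : ℕ} : PrimrecRel (IntervalSubset (i := i)) := by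
  have hp : Primrec fun q : List (Fin 2) × List (Fin i) => 2 ^ q.1.length :=
    primrec₂_pow.comp (Primrec.const 2) (Primrec.list_length.comp Primrec.fst)
  have hx : Primrec fun q : List (Fin 2) × List (Fin i) => i ^ q.2.length :=
    primrec₂_pow.comp (Primrec.const i) (Primrec.list_length.comp Primrec.snd)
  have vp : Primrec fun q : List (Fin 2) × List (Fin i) => baseValue 2 q.1 :=
    (primrec_baseValue 2).comp Primrec.fst
  have vx : Primrec fun q : List (Fin 2) × List (Fin i) => baseValue i q.2 :=
    (primrec_baseValue i).comp Primrec.snd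
  exact (Primrec.nat_le.comp (Primrec.nat_mul.comp vx hp) (Primrec.nat_mul.comp vp hx)).and
    (Primrec.nat_le.comp (Primrec.nat_mul.comp (Primrec.succ.comp vp) hx)
      (Primrec.nat_mul.comp (Primrec.succ.comp vx) hp))

/-- The interval of `x` has length `i ^ (-n)`, at least twice the mesh `2 ^ (-m)`, so it contains a
full cell of the dyadic grid. This is the reason for the extra bit in the length. -/
theorem exists_intervalSubset {i : ℕ} (hi : 1 ≤ i) (x : List (Fin i)) :
    ∃ p : List (Fin 2), p.length = Nat.clog 2 (i ^ x.length) + 1 ∧ IntervalSubset p x := by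
  set n := x.length with hn
  set m := Nat.clog 2 (i ^ n) + 1 with hm
  have hpos : 0 < i ^ n := pow_pos (by omega) n
  have hle : 2 * i ^ n ≤ 2 ^ m := by
    rw [hm, pow_succ, mul_comm]
    exact Nat.mul_le_mul_right 2 (Nat.le_pow_clog one_lt_two _)
  have hV := baseValue_lt x
  rw [← hn] at hV
  set V := baseValue i x
  -- The quotient rounded up: `k / 2 ^ m` is the first grid point not left of the interval of `x`.
  set k := (V * 2 ^ m + i ^ n - 1) / i ^ n with hk
  have h1 : V * 2 ^ m ≤ k * i ^ n := by
    have := Nat.lt_div_mul_add (a := V * 2 ^ m + i ^ n - 1) hpos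
    rw [← hk] at this
    omega
  have h2 : k * i ^ n ≤ V * 2 ^ m + i ^ n - 1 := Nat.div_mul_le_self _ _
  have h3 : (k + 1) * i ^ n ≤ (V + 1) * 2 ^ m := by
    rw [add_mul, add_mul]; omega
  have hk2 : k < 2 ^ m := by
    have : (k + 1) * i ^ n ≤ 2 ^ m * i ^ n :=
      h3.trans ((Nat.mul_le_mul_right _ hV).trans_eq (mul_comm _ _))
    exact Nat.le_of_mul_le_mul_right this hpos
  obtain ⟨p, hp, hpv⟩ := exists_baseValue_eq (b := 2) hk2
  refine ⟨p, hp, ?_⟩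
  rw [IntervalSubset, hp, hpv]
  exact ⟨h1, h3⟩

theorem IntervalSubset.append {i : ℕ} {p : List (Fin 2)} {x : List (Fin i)}
    (h : IntervalSubset p x) (q : List (Fin 2)) : IntervalSubset (p ++ q) x := by
  obtain ⟨h1, h2⟩ := h
  have hq := baseValue_lt q
  rw [IntervalSubset, baseValue_append, List.length_append, pow_add]
  have h1' := Nat.mul_le_mul_right (2 ^ q.length) h1
  have h2' := Nat.mul_le_mul_right (2 ^ q.length) h2
  have hq' := Nat.mul_le_mul_right (i ^ x.length) (Nat.succ_le_of_lt hq)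
  constructor
  · nlinarith [Nat.zero_le (baseValue 2 q * i ^ x.length)]
  · rw [Nat.succ_eq_add_one] at hq'
    nlinarith

/-- Base-`i` intervals of equal level are disjoint or equal. Those of `x` and of `y` truncated to
the length of `x` both contain the interval of `p`, so they coincide. -/
theorem IntervalSubset.prefix {i : ℕ} {p : List (Fin 2)} {x y : List (Fin i)}
    (hx : IntervalSubset p x) (hy : IntervalSubset p y) (hl : x.length ≤ y.length) : x <+: y := by
  obtain ⟨u, v, rfl, hu⟩ : ∃ u v, y = u ++ v ∧ u.length = x.length :=
    ⟨y.take x.length, y.drop x.length, (List.take_append_drop _ _).symm, by simp [hl]⟩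
  refine ⟨v, ?_⟩
  congr 1
  refine baseValue_injective hu.symm ?_
  obtain ⟨x1, x2⟩ := hx
  obtain ⟨y1, y2⟩ := hy
  have hv := baseValue_lt v
  rw [List.length_append, baseValue_append, hu, pow_add] at y1 y2
  have hi : 0 < i ^ v.length := by omega
  have hi' : 0 < i ^ x.length := (Nat.zero_le _).trans_lt (baseValue_lt x)
  have h2 : 0 < 2 ^ p.length := by positivity
  set B := baseValue 2 p
  set X := baseValue i x
  set Y := baseValue i u
  set W := baseValue i v
  set Q := 2 ^ p.length
  set a := i ^ x.length
  set b := i ^ v.length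
  have e1 : X < Y + 1 := by
    have h : X * Q * b < (Y + 1) * Q * b := by
      calc X * Q * b ≤ B * a * b := Nat.mul_le_mul_right _ x1
        _ < (B + 1) * (a * b) := by nlinarith [Nat.mul_pos hi' hi]
        _ ≤ (Y * b + W + 1) * Q := y2
        _ ≤ ((Y + 1) * b) * Q := Nat.mul_le_mul_right _ (by rw [add_mul]; omega)
        _ = (Y + 1) * Q * b := by ring
    exact lt_of_mul_lt_mul_right (lt_of_mul_lt_mul_right h b.zero_le) Q.zero_le
  have e2 : Y < X + 1 := by
    have h : Y * Q * b < (X + 1) * Q * b := by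
      calc Y * Q * b = Y * b * Q := by ring
        _ ≤ (Y * b + W) * Q := Nat.mul_le_mul_right _ (Nat.le_add_right _ _)
        _ ≤ B * (a * b) := y1
        _ < (B + 1) * a * b := by nlinarith [Nat.mul_pos hi' hi]
        _ ≤ (X + 1) * Q * b := Nat.mul_le_mul_right _ x2
    exact lt_of_mul_lt_mul_right (lt_of_mul_lt_mul_right h b.zero_le) Q.zero_le
  omega

/-- The strings of a computable prefix-free set have short descriptions. -/
theorem natComplexity_le_of_prefixFree {i : ℕ} (hi : 1 ≤ i) {α : Type*} [Primcodable α]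
    {P : α → Prop} (hP : PrimrecPred P) {f : α → List (Fin i)} (hf : Primrec f)
    (hpf : ∀ a b, P a → P b → f a <+: f b → a = b)
    {g : List (Fin i) →. List (Fin 2)} (hg : Partrec g)
    {U : List (Fin 2) →. List (Fin 2)} (hU : IsUniversal U) :
    ∃ c : ℕ, ∀ a, P a → ∀ y ∈ g (f a), natComplexity U y ≤ Nat.clog 2 (i ^ (f a).length) + c := by
  -- A code word for `a` has a length prescribed by `f a`. Then two comparable code words, which
  -- must decode to the same `a`, have equal length, so the decoder has a prefix-free domain.
  let R : List (Fin 2) → α → Prop := fun p a =>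
    P a ∧ p.length = Nat.clog 2 (i ^ (f a).length) + 1 ∧ IntervalSubset p (f a)
  have hR : PrimrecRel R := by
    refine PrimrecPred.and (hP.comp Primrec.snd) (PrimrecPred.and ?_ ?_)
    · exact Primrec.eq.comp (Primrec.list_length.comp Primrec.fst) (Primrec.succ.comp
        ((primrec_clog_pow hi).comp (Primrec.list_length.comp (hf.comp Primrec.snd))))
    · exact primrecRel_intervalSubset.comp Primrec.fst (hf.comp Primrec.snd)
  have uniq : ∀ p q a b, R p a → R (p ++ q) b → a = b := by
    rintro p q a b ⟨ha, -, hpa⟩ ⟨hb, -, hpb⟩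
    rcases le_total (f a).length (f b).length with h | h
    · exact hpf a b ha hb ((hpa.append q).prefix hpb h)
    · exact (hpf b a hb ha (hpb.prefix (hpa.append q) h)).symm
  obtain ⟨s, hs, s1, s2⟩ := exists_partrec_search hR
  have hT : IsMachine fun p => (s p).bind fun a => g (f a) := by
    refine ⟨hs.bind (hg.comp (hf.to_comp.comp Computable.snd)).to₂, fun p q hp hpq => ?_⟩
    replace hp : ((s p).bind fun a => g (f a)).Dom := hp
    replace hpq : ((s (p ++ q)).bind fun a => g (f a)).Dom := hpq
    have h1 := s1 _ _ (Part.get_mem hp.of_bind)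
    have h2 := s1 _ _ (Part.get_mem hpq.of_bind)
    have h := uniq _ _ _ _ h1 h2
    have hl := h2.2.1
    rw [← h, ← h1.2.1, List.length_append] at hl
    exact List.length_eq_zero_iff.1 (by omega)
  obtain ⟨c, hc⟩ := natComplexity_le hU hT
  refine ⟨c + 1, fun a ha y hy => ?_⟩
  obtain ⟨p, hp, hpa⟩ := exists_intervalSubset hi (f a)
  have hRa : R p a := ⟨ha, hp, hpa⟩
  have hsa : a ∈ s p := by
    have h := Part.get_mem (s2 _ _ hRa)
    have : a = _ := uniq p [] a _ hRa (by simpa using s1 _ _ h)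
    exact this ▸ h
  have := hc p y (Part.mem_bind hsa hy)
  omega

/-! ### Formulae are self-delimiting -/

namespace Symb

variable {S : Sig}

/-- Finiteness lets symbols be relabelled by some `Fin k`, on which every function is primitive
recursive. -/
instance : Finite (Symb S) := by
  let f : Symb S → (Fin 11 ⊕ Bool) ⊕ (Fin S.numFun ⊕ Fin S.numRel)
    | lpar => .inl (.inl 0)
    | rpar => .inl (.inl 1)
    | comma => .inl (.inl 2)
    | eq => .inl (.inl 3)
    | neg => .inl (.inl 4)
    | and => .inl (.inl 5)
    | or => .inl (.inl 6)
    | imp => .inl (.inl 7)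
    | all => .inl (.inl 8)
    | ex => .inl (.inl 9)
    | v => .inl (.inl 10)
    | bit b => .inl (.inr b)
    | fn f => .inr (.inl f)
    | rel r => .inr (.inr r)
  refine Finite.of_injective f fun a b h => ?_
  cases a <;> cases b <;> simp_all [f]

/-- `1` for an opening parenthesis, `2` for a closing one, `0` for the other symbols. -/
def parClass : Symb S → ℕ
  | lpar => 1
  | rpar => 2
  | _ => 0

end Symb

/-- An automaton that looks for the parenthesis which closes the first one. In state `0` no
parenthesis has been read, in state `1` that parenthesis has just been read, state `2` is reached
when anything follows it, and in state `d + 2` there are `d` open parentheses. -/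
def parStep (s c : ℕ) : ℕ :=
  if s = 0 then (if c = 1 then 3 else 0)
  else if s ≤ 2 then 2
  else if c = 1 then s + 1
  else if c = 2 then (if s = 3 then 1 else s - 1)
  else s

theorem primrec₂_parStep : Primrec₂ parStep := by
  have s : Primrec fun p : ℕ × ℕ => p.1 := Primrec.fst
  have c : Primrec fun p : ℕ × ℕ => p.2 := Primrec.snd
  have e : ∀ (f : ℕ × ℕ → ℕ) (n : ℕ), Primrec f → PrimrecPred fun p => f p = n :=
    fun f n hf => Primrec.eq.comp hf (Primrec.const n)
  exact Primrec.ite (e _ 0 s) (Primrec.ite (e _ 1 c) (Primrec.const 3) (Primrec.const 0))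
    (Primrec.ite (Primrec.nat_le.comp s (Primrec.const 2)) (Primrec.const 2)
      (Primrec.ite (e _ 1 c) (Primrec.succ.comp s)
        (Primrec.ite (e _ 2 c) (Primrec.ite (e _ 3 s) (Primrec.const 1) (Primrec.pred.comp s)) s)))

/-- The state of the automaton after reading `w` in state `s`. -/
def parRun {S : Sig} (s : ℕ) (w : List (Symb S)) : ℕ :=
  w.foldl (fun s a => parStep s a.parClass) s

section

variable {S : Sig}

theorem parRun_append (s : ℕ) (u w : List (Symb S)) :
    parRun s (u ++ w) = parRun (parRun s u) w :=
  List.foldl_append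

theorem parRun_cons (s : ℕ) (a : Symb S) (w : List (Symb S)) :
    parRun s (a :: w) = parRun (parStep s a.parClass) w :=
  rfl

theorem parRun_two (w : List (Symb S)) : parRun 2 w = 2 := by
  induction w with
  | nil => rfl
  | cons a w ih => rw [parRun_cons]; exact ih

/-- Any symbol read in state `1` leads to state `2`, which is absorbing. -/
theorem eq_nil_of_parRun_append {u z : List (Symb S)} (hu : parRun 0 u = 1)
    (h : parRun 0 (u ++ z) = 1) : z = [] := by
  cases z with
  | nil => rfl
  | cons a z =>
    rw [parRun_append, hu, parRun_cons] at h
    have := parRun_two z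
    simp_all [parStep]

/-- The parentheses in `w` match. -/
def ParNeutral (w : List (Symb S)) : Prop :=
  ∀ s, 3 ≤ s → parRun s w = s

theorem parNeutral_nil : ParNeutral ([] : List (Symb S)) := fun _ _ => rfl

theorem ParNeutral.append {u w : List (Symb S)} (hu : ParNeutral u) (hw : ParNeutral w) :
    ParNeutral (u ++ w) := fun s hs => by rw [parRun_append, hu s hs, hw s hs]

theorem ParNeutral.cons {a : Symb S} {w : List (Symb S)} (ha : a.parClass = 0)
    (hw : ParNeutral w) : ParNeutral (a :: w) := fun s hs => by
  rw [parRun_cons, ha]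
  have h0 : s ≠ 0 := by omega
  have h2 : ¬ s ≤ 2 := by omega
  have : parStep s 0 = s := by simp [parStep, h0, h2]
  rw [this, hw s hs]

theorem ParNeutral.intercalate {l : List (List (Symb S))} (h : ∀ w ∈ l, ParNeutral w) :
    ParNeutral (List.intercalate [Symb.comma] l) := by
  have hc : ParNeutral (S := S) [Symb.comma] := parNeutral_nil.cons rfl
  match l with
  | [] => exact parNeutral_nil
  | [w] => simpa [List.intercalate] using h w (by simp)
  | w :: u :: l =>
    have ih := ParNeutral.intercalate (l := u :: l) fun x hx => h x (List.mem_cons_of_mem _ hx)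
    have hw := (h w (by simp)).append (hc.append ih)
    simpa [List.intercalate] using hw

theorem ParNeutral.paren {w : List (Symb S)} (h : ParNeutral w) :
    ParNeutral (Symb.lpar :: w ++ [Symb.rpar]) := fun s hs => by
  rw [List.cons_append, parRun_cons, parRun_append]
  have h0 : s ≠ 0 := by omega
  have h2 : ¬ s ≤ 2 := by omega
  have h1 : parStep s (Symb.lpar (S := S)).parClass = s + 1 := by
    simp [parStep, Symb.parClass, h0, h2]
  have h3 : parStep (s + 1) (Symb.rpar (S := S)).parClass = s := by
    have h3 : ¬ s + 1 ≤ 2 := by omega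
    have h4 : s ≠ 2 := by omega
    simp [parStep, Symb.parClass, h3, h4]
  rw [h1, h _ (by omega), parRun_cons, h3]
  rfl

theorem ParNeutral.parRun_paren {w : List (Symb S)} (h : ParNeutral w) :
    parRun 0 (Symb.lpar :: w ++ [Symb.rpar]) = 1 := by
  rw [List.cons_append, parRun_cons, parRun_append]
  have h1 : parStep 0 (Symb.lpar (S := S)).parClass = 3 := rfl
  rw [h1, h _ le_rfl]
  rfl

theorem parRun_zero_cons {a : Symb S} (ha : a.parClass = 0) (w : List (Symb S)) :
    parRun 0 (a :: w) = parRun 0 w := by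
  rw [parRun_cons, ha]; rfl

theorem parNeutral_bits (l : List Bool) : ParNeutral (S := S) (l.map Symb.bit) := by
  induction l with
  | nil => exact parNeutral_nil
  | cons b l ih => exact ih.cons rfl

theorem parNeutral_varSyms (n : ℕ) : ParNeutral (S := S) (varSyms n) :=
  (parNeutral_bits _).cons rfl

theorem parRun_zero_varSyms (n : ℕ) (w : List (Symb S)) : parRun 0 (varSyms n ++ w) = parRun 0 w := by
  rw [varSyms, List.cons_append, parRun_zero_cons rfl]
  induction binaryDigits n with
  | nil => rfl
  | cons b l ih => rwa [List.map_cons, List.cons_append, parRun_zero_cons rfl]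

theorem parNeutral_args {k : ℕ} {w : Fin k → List (Symb S)} (h : ∀ j, ParNeutral (w j)) :
    ParNeutral (List.intercalate [Symb.comma] (List.ofFn w)) :=
  ParNeutral.intercalate fun u hu => by
    obtain ⟨j, rfl⟩ := (List.mem_ofFn' _ _).1 hu
    exact h j

theorem Trm.parNeutral_syms (t : Trm S) : ParNeutral t.syms := by
  induction t with
  | var n => exact parNeutral_varSyms n
  | app f args ih => exact (parNeutral_args ih).paren.cons rfl

theorem ParNeutral.binary {u w : List (Symb S)} {a : Symb S} (hu : ParNeutral u)
    (ha : a.parClass = 0) (hw : ParNeutral w) : ParNeutral (u ++ [a] ++ w) :=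
  (hu.append (parNeutral_nil.cons ha)).append hw

theorem Fml.parNeutral_syms (φ : Fml S) : ParNeutral φ.syms := by
  induction φ with
  | eq s t => exact (s.parNeutral_syms.binary rfl t.parNeutral_syms).paren
  | rel r args => exact (parNeutral_args fun j => (args j).parNeutral_syms).paren.cons rfl
  | neg φ ih => exact ih.cons rfl
  | and φ ψ h1 h2 => exact (h1.binary rfl h2).paren
  | or φ ψ h1 h2 => exact (h1.binary rfl h2).paren
  | imp φ ψ h1 h2 => exact (h1.binary rfl h2).paren
  | all n φ ih => exact ((parNeutral_varSyms n).append ih).cons rfl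
  | ex n φ ih => exact ((parNeutral_varSyms n).append ih).cons rfl

/-- A formula is a parenthesis-free string followed by one matched parenthesised block. Atoms fit
this too, since argument lists carry parentheses even when empty. -/
theorem Fml.parRun_syms (φ : Fml S) : parRun 0 φ.syms = 1 := by
  induction φ with
  | eq s t => exact (s.parNeutral_syms.binary rfl t.parNeutral_syms).parRun_paren
  | rel r args =>
    exact (parRun_zero_cons rfl _).trans
      (parNeutral_args fun j => (args j).parNeutral_syms).parRun_paren
  | neg φ ih => exact (parRun_zero_cons rfl _).trans ih
  | and φ ψ => exact (φ.parNeutral_syms.binary rfl ψ.parNeutral_syms).parRun_paren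
  | or φ ψ => exact (φ.parNeutral_syms.binary rfl ψ.parNeutral_syms).parRun_paren
  | imp φ ψ => exact (φ.parNeutral_syms.binary rfl ψ.parNeutral_syms).parRun_paren
  | all n φ ih =>
    exact (parRun_zero_cons rfl _).trans ((parRun_zero_varSyms n _).trans ih)
  | ex n φ ih =>
    exact (parRun_zero_cons rfl _).trans ((parRun_zero_varSyms n _).trans ih)

end

/-- Two blocks that begin the same string are comparable, hence equal, so the symbols can be read
off one at a time. -/
theorem prefix_of_flatMap_prefix {α β : Type*} {code : α → List β}
    (h : ∀ a b, code a <+: code b → a = b) (hne : ∀ a, code a ≠ []) {u w : List α}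
    (huw : u.flatMap code <+: w.flatMap code) : u <+: w := by
  induction u generalizing w with
  | nil => exact List.nil_prefix
  | cons a u ih =>
    cases w with
    | nil =>
      simp only [List.flatMap_cons, List.flatMap_nil, List.prefix_nil, List.append_eq_nil_iff] at huw
      exact absurd huw.1 (hne a)
    | cons b w =>
      simp only [List.flatMap_cons] at huw
      have hab : a = b := by
        rcases List.prefix_or_prefix_of_prefix ((List.prefix_append _ _).trans huw)
          (List.prefix_append (code b) (w.flatMap code)) with h' | h'
        · exact h a b h'
        · exact (h b a h').symm
      subst hab
      exact (List.prefix_cons_inj a).2 (ih ((List.prefix_append_right_inj _).1 huw))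

/-- The written forms of the formulae of a theory have short descriptions. -/
theorem GodelTheory.natComplexity_le {i : ℕ} (hi : 1 ≤ i) (F : GodelTheory i)
    {g : List (Fin i) →. List (Fin 2)} (hg : Partrec g)
    {U : List (Fin 2) →. List (Fin 2)} (hU : IsUniversal U) :
    ∃ c : ℕ, ∀ φ : Fml F.sig, ∀ y ∈ g (φ.syms.flatMap F.code),
      natComplexity U y ≤ Nat.clog 2 (i ^ (φ.syms.flatMap F.code).length) + c := by
  obtain ⟨k, ⟨e⟩⟩ := Finite.exists_equiv_fin (Symb F.sig)
  let f : List (Fin k) → List (Fin i) := fun l => l.flatMap fun a => F.code (e.symm a)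
  -- Larger than the set of formulae, but still prefix-free and decidable without any parsing.
  let P : List (Fin k) → Prop := fun l => parRun 0 (l.map e.symm) = 1
  have hf : Primrec f :=
    Primrec.list_flatMap Primrec.id
      ((Primrec.dom_finite fun a => F.code (e.symm a)).comp Primrec.snd).to₂
  have hP : PrimrecPred P := by
    have hs : Primrec₂ fun (_ : List (Fin k)) (q : ℕ × Fin k) =>
        parStep q.1 (e.symm q.2).parClass :=
      primrec₂_parStep.comp (Primrec.fst.comp Primrec.snd)
        ((Primrec.dom_finite fun a => (e.symm a).parClass).comp (Primrec.snd.comp Primrec.snd))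
    have h : Primrec fun l : List (Fin k) =>
        l.foldl (fun s a => parStep s (e.symm a).parClass) 0 :=
      Primrec.list_foldl Primrec.id (Primrec.const 0) hs
    refine (Primrec.eq.comp h (Primrec.const 1)).of_eq fun l => ?_
    simp [P, parRun, List.foldl_map]
  -- An empty block would be an initial segment of every block, leaving only one symbol.
  have hne : ∀ a, F.code a ≠ [] := by
    intro a ha
    have h : ∀ b, a = b := fun b => F.code_prefixFree a b (by simp [ha])
    exact absurd ((h Symb.lpar).symm.trans (h Symb.rpar)) (by simp)
  have hfe : ∀ l, f l = (l.map e.symm).flatMap F.code := by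
    intro l
    simp [f, List.flatMap_map]
  obtain ⟨c, hc⟩ := natComplexity_le_of_prefixFree hi hP hf (by
    intro a b ha hb hab
    rw [hfe, hfe] at hab
    obtain ⟨z, hz⟩ := prefix_of_flatMap_prefix F.code_prefixFree hne hab
    have h0 : z = [] := eq_nil_of_parRun_append ha (by rw [hz]; exact hb)
    rw [h0, List.append_nil] at hz
    exact (List.map_injective_iff.2 e.symm.injective) hz) hg hU
  refine ⟨c, fun φ y hy => ?_⟩
  have hφ : f (φ.syms.map e) = φ.syms.flatMap F.code := by simp [hfe]
  rw [← hφ] at hy ⊢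
  exact hc _ (by simpa [P] using φ.parRun_syms) y hy

/-! ### The measure `δ` -/

section

variable {i : ℕ} {L : Set (List (Fin i))} {U : List (Fin 2) →. List (Fin 2)}

theorem GodelNumbering.val_mem (g : GodelNumbering L) (x : L) : g.val x ∈ g.toFun x :=
  Part.get_mem _

theorem GodelNumbering.val_injective (g : GodelNumbering L) : Function.Injective g.val := by
  intro x y h
  exact Subtype.ext (g.inj _ _ _ (g.val_mem x) (h ▸ g.val_mem y))

theorem delta_eq (hi : 1 ≤ i) (g : GodelNumbering L) (x : L) :
    delta U g x = (natComplexity U (g.val x) : ℚ) - Nat.clog 2 (i ^ x.1.length) := by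
  rw [delta, ceil_logb_mul hi, Int.cast_natCast]

theorem isBuilder_delta (hi : 1 ≤ i) : IsBuilder U fun g : GodelNumbering L => delta U g := by
  refine ⟨fun p => (p.1 : ℚ) - Nat.clog 2 (i ^ p.2), ⟨Prod.fst, fun p => Nat.clog 2 (i ^ p.2),
    fun _ => 0, Computable.fst, (primrec_clog_pow hi).to_comp.comp Computable.snd,
    Computable.const 0, fun p => by simp⟩, fun g u => delta_eq hi g u⟩

/-- The computable map `g' ∘ g⁻¹` sends `g(u)` to `g'(u)`. -/
theorem exists_natComplexity_val_le (hU : IsUniversal U) (g g' : GodelNumbering L) :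
    ∃ c : ℕ, ∀ u : L, natComplexity U (g'.val u) ≤ natComplexity U (g.val u) + c := by
  obtain ⟨h, hh, hmem⟩ := exists_partrec_inverse g.partrec g.inj
  obtain ⟨c, hc⟩ := exists_natComplexity_map_le hU (f := fun y => (h y).bind g'.toFun)
    (hh.bind (g'.partrec.comp Computable.snd).to₂)
  exact ⟨c, fun u => hc _ _ (Part.mem_bind ((hmem _ _).2 (g.val_mem u)) (g'.val_mem u))⟩

theorem exists_abs_delta_sub_le (hU : IsUniversal U) (g g' : GodelNumbering L) :
    ∃ c : ℚ, ∀ u : L, |delta U g u - delta U g' u| ≤ c := by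
  obtain ⟨c, hc⟩ := exists_natComplexity_val_le hU g g'
  obtain ⟨d, hd⟩ := exists_natComplexity_val_le hU g' g
  refine ⟨c + d, fun u => ?_⟩
  have h1 : (natComplexity U (g'.val u) : ℚ) ≤ natComplexity U (g.val u) + c := by
    exact_mod_cast hc u
  have h2 : (natComplexity U (g.val u) : ℚ) ≤ natComplexity U (g'.val u) + d := by
    exact_mod_cast hd u
  have hc0 : (0 : ℚ) ≤ c := c.cast_nonneg
  have hd0 : (0 : ℚ) ≤ d := d.cast_nonneg
  rw [delta, delta, sub_sub_sub_cancel_right, abs_le]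
  constructor <;> linarith

theorem exists_delta_lt_of_proves (hi : 1 ≤ i) (hU : IsUniversal U) (g : GodelNumbering L)
    (F : GodelTheory i) : ∃ N : ℤ, ∀ x : L, F.Proves x → delta U g x < N := by
  obtain ⟨c, hc⟩ := F.natComplexity_le hi g.partrec hU
  -- The `+ 1` makes the inequality strict.
  refine ⟨c + 1, fun x ⟨φ, _, hφ⟩ => ?_⟩
  have h : (natComplexity U (g.val x) : ℚ) ≤ Nat.clog 2 (i ^ x.1.length) + c := by
    have := hc φ (g.val x) (hφ ▸ g.val_mem x)
    rw [hφ] at this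
    exact_mod_cast this
  rw [delta_eq hi]
  push_cast
  linarith

theorem two_pow_clog_le {m : ℕ} (hm : 1 ≤ m) : 2 ^ Nat.clog 2 m ≤ 2 * m := by
  cases h : Nat.clog 2 m with
  | zero => omega
  | succ k =>
    rw [pow_succ, mul_comm]
    exact Nat.mul_le_mul_left 2 (Nat.pow_lt_of_lt_clog (by omega)).le

/-- A shortest program for `g(x)` determines `g(x)`, hence `x`. Replacing a negative `N` by `0` only
enlarges the right-hand set. -/
theorem ncard_delta_le (hi : 1 ≤ i) (hU : IsUniversal U) (g : GodelNumbering L) (N : ℤ) (n : ℕ) :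
    Set.ncard {x : L | x.1.length = n ∧ delta U g x ≤ N} ≤
      Set.ncard {p ∈ {p | (U p).Dom} | p.length ≤ Nat.clog 2 (i ^ n) + N.toNat} := by
  choose p hp hl using fun x : L => exists_program hU (g.val x)
  -- The target must be known to be finite, since `Set.ncard` is `0` on infinite sets.
  refine Set.ncard_le_ncard_of_injOn p (fun x hx => ?_) (fun x _ y _ h => ?_) (finite_length_le _ _)
  · obtain ⟨rfl, hx⟩ := hx
    refine ⟨Part.dom_iff_mem.2 ⟨_, hp x⟩, ?_⟩
    rw [delta_eq hi] at hx
    have h : (natComplexity U (g.val x) : ℤ) - Nat.clog 2 (i ^ x.1.length) ≤ N := by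
      exact_mod_cast hx
    rw [hl]
    omega
  · exact g.val_injective (Part.mem_unique (hp x) (h ▸ hp y))

theorem tendsto_ncard_delta (hi : 2 ≤ i) (hU : IsUniversal U) (g : GodelNumbering L) (N : ℤ) :
    Tendsto (fun n : ℕ => ((i : ℝ) ^ n)⁻¹ *
      (Set.ncard {x : L | x.1.length = n ∧ delta U g x ≤ N} : ℝ)) atTop (𝓝 0) := by
  have hk : Tendsto (fun n => Nat.clog 2 (i ^ n) + N.toNat) atTop atTop := by
    refine tendsto_atTop_mono (fun n => ?_) tendsto_id
    calc n = Nat.clog 2 (2 ^ n) := (Nat.clog_pow 2 n one_lt_two).symm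
      _ ≤ Nat.clog 2 (i ^ n) := Nat.clog_mono_right 2 (Nat.pow_le_pow_left hi n)
      _ ≤ _ := Nat.le_add_right _ _
  -- The factor `2` pays for rounding up the logarithm (`two_pow_clog_le`), and `2 ^ N.toNat` for
  -- the shift of the length bound.
  have h := (hU.1.2.tendsto_ncard.comp hk).const_mul (2 * 2 ^ N.toNat)
  rw [mul_zero] at h
  refine squeeze_zero (fun n => by positivity) (fun n => ?_) h
  have hpos : (0 : ℝ) < (i : ℝ) ^ n := by
    have : (0 : ℝ) < i := by exact_mod_cast (by omega : 0 < i)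
    positivity
  have h1 : ((i : ℝ) ^ n)⁻¹ ≤ 2 / 2 ^ Nat.clog 2 (i ^ n) := by
    rw [inv_eq_one_div, div_le_div_iff₀ hpos (by positivity), one_mul]
    exact_mod_cast two_pow_clog_le (Nat.one_le_pow n i (by omega))
  calc ((i : ℝ) ^ n)⁻¹ * (Set.ncard {x : L | x.1.length = n ∧ delta U g x ≤ N} : ℝ)
      ≤ 2 / 2 ^ Nat.clog 2 (i ^ n) * (Set.ncard {p ∈ {p | (U p).Dom} |
          p.length ≤ Nat.clog 2 (i ^ n) + N.toNat} : ℝ) := by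
        gcongr
        exact ncard_delta_le (by omega) hU g N n
    _ = _ := by
        simp only [Function.comp_apply, pow_add]
        field_simp

theorem isAcceptableBuilder_delta (hi : 2 ≤ i) (hU : IsUniversal U) :
    IsAcceptableBuilder U fun g : GodelNumbering L => delta U g where
  builder := isBuilder_delta (by omega)
  bound := exists_delta_lt_of_proves (by omega) hU
  lim := tendsto_ncard_delta hi hU
  inva := exists_abs_delta_sub_le hU

end

theorem mainTheorem2 (i : ℕ) (hi : 2 ≤ i) (L : Set (List (Fin i)))
    (U : List (Fin 2) →. List (Fin 2)) (hU : IsUniversal U) :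
    IsAcceptableBuilder U (fun g : GodelNumbering L => delta U g) ∧
      ∀ g : GodelNumbering L, IsAcceptableMeasure U (delta U g) :=
  ⟨isAcceptableBuilder_delta hi hU, fun g => ⟨_, isAcceptableBuilder_delta hi hU, g, rfl⟩⟩
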